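/- Let $n,m\ge 1$ be integers and $\mathbf m=\{1,\dots,m\}$. Consider the $m$-channel linear system $\dot x=Ax+\sum_{i=1}^m B_iu_i$, $y_i=C_ix$ $(i\in\mathbf m)$ with $x\in\mathbb R^n$, $u_i\in\mathbb R^{m_i}$, $y_i\in\mathbb R^{p_i}$ and real constant matrices $A,B_i,C_i$. Assume that it is jointly controllable and jointly observable, i.e. that the pair $(A,[B_1\ \cdots\ B_m])$ is controllable and the pair $(\mathrm{col}(C_1,\dots,C_m),A)$ is observable. For each $i\in\mathbf m$ let $\mathcal N_i\subseteq\mathbf m$ be the set of neighbors of agent $i$, with $i\in\mathcal N_i$, and assume that the directed graph on $\mathbf m$ with an arc from $j$ to $i$ exactly when $j\in\mathcal N_i$ is strongly connected. Let $F_i\in\mathbb R^{m_i\times n}$, $i\in\mathbf m$, be arbitrary given feedback matrices. Then there exist real matrices $K_i\in\mathbb R^{n\times p_i}$ $(i\in\mathbf m)$ and $H_{ij}\in\mathbb R^{n\times n}$ $(i\in\mathbf m,\ j\in\mathcal N_i)$ such that for every $q\in\mathbf m$ the open-loop error system with state $(e_1,\dots,e_m)\in(\mathbb R^n)^m$, input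 $\tilde u_q\in\mathbb R^n$ and output $\tilde y_q$, $$\dot e_i=(A+K_iC_i)e_i+\sum_{j\in\mathcal N_i}H_{ij}(e_i-e_j)+\sum_{j=1}^mB_jF_j(e_i-e_j)+\delta_{iq}\tilde u_q,\quad i\in\mathbf m,$$ $$\tilde y_q=\big(C_qe_q,\ (e_q-e_j)_{j\in\mathcal N_q}\big),$$ is observable through $\tilde y_q$ and controllable by $\tilde u_q$, with controllability index exactly $m$. (Here $\delta_{iq}$ is the Kronecker delta. A pair $(M,G)$ with state dimension $d$ is controllable if $[G\ \ MG\ \cdots\ M^{d-1}G]$ has rank $d$; its controllability index is then the least $k$ for which $[G\ \ MG\ \cdots\ M^{k-1}G]$ has rank $d$. A pair $(L,M)$ is observable if $\mathrm{col}(L,LM,\dots,LM^{d-1})$ has rank $d$.) -/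

import Mathlib

open scoped Matrix

namespace MultiChannel

section LinearSystems

variable {X U Y : Type*} [AddCommGroup X] [Module ℝ X] [AddCommGroup U] [Module ℝ U]
  [AddCommGroup Y] [Module ℝ Y]

/-- The image of the partial controllability matrix `[B, A B, …, A ^ (k - 1) B]`. -/
def controllableSubspace (A : X →ₗ[ℝ] X) (B : U →ₗ[ℝ] X) (k : ℕ) : Submodule ℝ X :=
  ⨆ j : Fin k, LinearMap.range ((A ^ (j : ℕ)) ∘ₗ B)

/-- The pair `(A, B)` is controllable: with `n = dim X`, the controllability matrix
`[B, A B, …, A ^ (n - 1) B]` has full rank `n`. -/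
def IsControllable (A : X →ₗ[ℝ] X) (B : U →ₗ[ℝ] X) : Prop :=
  controllableSubspace A B (Module.finrank ℝ X) = ⊤

/-- The controllability index of `(A, B)` is `k`: it is the least number such that
`[B, A B, …, A ^ (k - 1) B]` has full rank. -/
def HasControllabilityIndex (A : X →ₗ[ℝ] X) (B : U →ₗ[ℝ] X) (k : ℕ) : Prop :=
  IsLeast {l : ℕ | controllableSubspace A B l = ⊤} k

/-- The pair `(C, A)` is observable: with `n = dim X`, the observability matrix with block rows
`C, C A, …, C A ^ (n - 1)` has trivial kernel. -/
def IsObservable (C : X →ₗ[ℝ] Y) (A : X →ₗ[ℝ] X) : Prop :=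
  ⨅ j : Fin (Module.finrank ℝ X), LinearMap.ker (C ∘ₗ (A ^ (j : ℕ))) = ⊥

end LinearSystems

section Channels

variable {n m : ℕ} {r p : Fin m → ℕ}

/-- The input map `[B₁, …, B_m]`, that is `(u₁, …, u_m) ↦ B₁ u₁ + ⋯ + B_m u_m`. -/
def jointInput (B : ∀ i, Matrix (Fin n) (Fin (r i)) ℝ) :
    (∀ i, Fin (r i) → ℝ) →ₗ[ℝ] (Fin n → ℝ) where
  toFun u := ∑ i, B i *ᵥ u i
  map_add' u v := by simp [Matrix.mulVec_add, Finset.sum_add_distrib]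
  map_smul' c u := by simp [Matrix.mulVec_smul, Finset.smul_sum]

/-- The output map `col (C₁, …, C_m)`, that is `x ↦ (C₁ x, …, C_m x)`. -/
def jointOutput (C : ∀ i, Matrix (Fin (p i)) (Fin n) ℝ) :
    (Fin n → ℝ) →ₗ[ℝ] (∀ i, Fin (p i) → ℝ) where
  toFun x := fun i => C i *ᵥ x
  map_add' x y := by ext1 i; simp [Matrix.mulVec_add]
  map_smul' c x := by ext1 i; simp [Matrix.mulVec_smul]

/-- The neighbor graph: there is an arc from `j` to `i` iff `j` is a neighbor of `i`. -/
def neighborGraph (N : Fin m → Finset (Fin m)) : Digraph (Fin m) where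
  Adj j i := j ∈ N i

/-- Every vertex can be reached from every vertex along a directed path. -/
def IsStronglyConnected {V : Type*} (G : Digraph V) : Prop :=
  ∀ i j : V, Relation.ReflTransGen G.Adj i j

/-- The map on states `e = (e₁, …, e_m)` of the unforced open-loop error system
`ė_i = (A + K_i C_i) e_i + ∑_{j ∈ N_i} H_ij (e_i - e_j) + ∑_j B_j F_j (e_i - e_j)`. -/
def errorDynamics (A : Matrix (Fin n) (Fin n) ℝ) (B : ∀ i, Matrix (Fin n) (Fin (r i)) ℝ)
    (C : ∀ i, Matrix (Fin (p i)) (Fin n) ℝ) (F : ∀ i, Matrix (Fin (r i)) (Fin n) ℝ)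
    (N : Fin m → Finset (Fin m)) (K : ∀ i, Matrix (Fin n) (Fin (p i)) ℝ)
    (H : ∀ i, {j // j ∈ N i} → Matrix (Fin n) (Fin n) ℝ) :
    (Fin m → Fin n → ℝ) →ₗ[ℝ] (Fin m → Fin n → ℝ) where
  toFun e := fun i => (A + K i * C i) *ᵥ e i + ∑ j : {j // j ∈ N i}, H i j *ᵥ (e i - e j)
    + ∑ j, (B j * F j) *ᵥ (e i - e j)
  map_add' e f := by
    ext1 i
    simp only [Pi.add_apply, add_sub_add_comm, Matrix.mulVec_add, Finset.sum_add_distrib]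
    abel
  map_smul' c e := by
    ext1 i
    simp only [Pi.smul_apply, ← smul_sub, Matrix.mulVec_smul, ← Finset.smul_sum, ← smul_add,
      RingHom.id_apply]

/-- The input `ũ_q ∈ ℝⁿ` enters the `i`th equation of the error system as `δ_iq ũ_q`. -/
def errorInput (n : ℕ) {m : ℕ} (q : Fin m) : (Fin n → ℝ) →ₗ[ℝ] (Fin m → Fin n → ℝ) where
  toFun u := fun i => if i = q then u else 0
  map_add' u v := by ext1 i; by_cases h : i = q <;> simp [h]
  map_smul' c u := by ext1 i; by_cases h : i = q <;> simp [h]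

/-- The output `ỹ_q` of the error system: `C_q e_q` together with `e_q - e_j` for all `j ∈ N_q`. -/
def errorOutput (C : ∀ i, Matrix (Fin (p i)) (Fin n) ℝ) (N : Fin m → Finset (Fin m)) (q : Fin m) :
    (Fin m → Fin n → ℝ) →ₗ[ℝ] (Fin (p q) → ℝ) × ({j // j ∈ N q} → Fin n → ℝ) where
  toFun e := (C q *ᵥ e q, fun j => e q - e j)
  map_add' e f := by
    refine Prod.ext ?_ (funext fun j => ?_)
    · simp [Matrix.mulVec_add]
    · simp [add_sub_add_comm]
  map_smul' c e := by
    refine Prod.ext ?_ (funext fun j => ?_)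
    · simp [Matrix.mulVec_smul]
    · simp [smul_sub]

end Channels

end MultiChannel

namespace MultiChannel

/-! ### Line-genericity of controllability and observability -/

section Genericity

open Polynomial

variable {V W X U Y : Type*} [AddCommGroup V] [Module ℝ V] [AddCommGroup W] [Module ℝ W]
  [AddCommGroup X] [Module ℝ X] [AddCommGroup U] [Module ℝ U] [AddCommGroup Y] [Module ℝ Y]

/-! The error dynamics are affine in `(K, H)`, and each required property amounts to the
nonvanishing of some minor. This is used only along lines (`LineGeneric`): a property that holds at
one point of a line fails at only finitely many of its points. Hence every vertex `q` and each of
the two properties may be treated with gains of their own, which `LineGeneric.exists_forall` and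
`LineGeneric.exists_and` merge at the end. The same principle replaces asymptotic estimates: if the
limit `t = 0` of an affine family has the property, so does some member with `t > 0`.

Controllability in `m` steps: with couplings `t⁻¹ h i j • 1`, the rescaled limit is a pure graph
Laplacian. A tree rooted at `q` with distinct weights has simple spectrum and left eigenvectors that
do not vanish at `q`, so a Vandermonde determinant concludes
(`exists_controllable_laplacian_of_tree`). Fewer than `m` steps are excluded by counting dimensions.

Observability: duality on the reversed graph gives a Laplacian observable at `q` with a positive
left null vector `π` (`exists_observable_laplacian`). Couple copies of `A` by this Laplacian at high
gain, with relatively weak local terms proportional to `(π i)⁻¹ C iᵀ C i`. In the limit, the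
rescaled differences are in equilibrium with the common state; averaging with `π` leaves `∑ C iᵀ C
i`, and joint observability recovers that state (`exists_isObservable_cascade`,
`exists_isObservable_network`). -/

theorem exists_polynomial_det [Module.Finite ℝ V] {ι : Type*} [Fintype ι]
    (R S : ι → Module.End ℝ V) (k : ι → ℕ) (M M' : Module.End ℝ V) :
    ∃ P : ℝ[X], ∀ t : ℝ,
      LinearMap.det (∑ i, R i * ((1 - t) • M + t • M') ^ k i * S i) = P.eval t := by
  classical
  let b := Module.finBasis ℝ V
  let φ := LinearMap.toMatrixAlgEquiv b
  let d := Fin (Module.finrank ℝ V)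
  let c : Matrix d d ℝ → Matrix d d ℝ[X] := fun N => N.map (C : ℝ →+* ℝ[X])
  let Q := ∑ i, c (φ (R i)) * ((1 - X : ℝ[X]) • c (φ M) + (X : ℝ[X]) • c (φ M')) ^ k i *
    c (φ (S i))
  refine ⟨Q.det, fun t => ?_⟩
  have hc (N) : (evalRingHom t).mapMatrix (c N) = N := by
    ext i j; simp [c]
  have hsmul (p : ℝ[X]) (N : Matrix d d ℝ) :
      (evalRingHom t).mapMatrix (p • c N) = p.eval t • N := by
    ext i j; simp [c]
  rw [← LinearMap.det_toMatrix b, ← coe_evalRingHom, RingHom.map_det]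
  congr 1
  change φ _ = _
  simp only [Q, map_sum, map_mul, map_pow, map_add, map_smul, hsmul, hc, eval_sub, eval_one,
    eval_X]

/-- The determinant is a polynomial in `t` with value 1 at `t = 0`. The shape `R * M ^ k * S` covers
a Krylov map composed with a one-sided inverse on either side, hence both controllability and
observability. -/
theorem finite_setOf_not_bijective [Module.Finite ℝ V] {ι : Type*} [Fintype ι]
    (R S : ι → Module.End ℝ V) (k : ι → ℕ) (M M' : Module.End ℝ V)
    (h : ∑ i, R i * M ^ k i * S i = 1) :
    {t : ℝ | ¬ Function.Bijective
      (∑ i, R i * ((1 - t) • M + t • M') ^ k i * S i : Module.End ℝ V)}.Finite := by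
  obtain ⟨P, hP⟩ := exists_polynomial_det R S k M M'
  have hP0 : P ≠ 0 := by
    rintro rfl
    have := hP 0
    simp [h] at this
  refine (P.rootSet_finite ℝ).subset fun t ht => ?_
  rw [mem_rootSet]
  refine ⟨hP0, ?_⟩
  rw [coe_aeval_eq_eval, ← hP]
  by_contra hdet
  apply ht
  exact (Module.End.isUnit_iff _).1
    ((LinearMap.isUnit_iff_isUnit_det _).2 (isUnit_iff_ne_zero.2 hdet))

/-- The property `S` holds on a line, up to finitely many points, once it holds somewhere on it. -/
def LineGeneric (S : V → Prop) : Prop :=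
  ∀ v w, S v → {t : ℝ | ¬ S ((1 - t) • v + t • w)}.Finite

theorem LineGeneric.and {S T : V → Prop} (hS : LineGeneric S) (hT : LineGeneric T) :
    LineGeneric fun v => S v ∧ T v := fun v w h =>
  ((hS v w h.1).union (hT v w h.2)).subset fun t ht => by
    simp only [Set.mem_union, Set.mem_ofPred_eq] at ht ⊢
    tauto

theorem LineGeneric.exists_and {S T : V → Prop} (hS : LineGeneric S) (hT : LineGeneric T)
    (hS' : ∃ v, S v) (hT' : ∃ v, T v) : ∃ v, S v ∧ T v := by
  obtain ⟨v, hv⟩ := hS'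
  obtain ⟨w, hw⟩ := hT'
  -- The same line is run backwards from `w`, so its parameter is `1 - t`.
  have h2 := (hT w v hw).preimage (f := fun t : ℝ => 1 - t) (sub_right_injective.injOn)
  obtain ⟨t, ht⟩ := ((hS v w hv).union h2).infinite_compl.nonempty
  simp only [Set.mem_compl_iff, Set.mem_union, Set.mem_ofPred_eq, Set.mem_preimage, not_or,
    not_not, sub_sub_cancel] at ht
  exact ⟨_, ht.1, by rw [add_comm]; exact ht.2⟩

theorem LineGeneric.exists_forall {ι : Type*} [Finite ι] {S : ι → V → Prop}
    (hS : ∀ i, LineGeneric (S i)) (h : ∀ i, ∃ v, S i v) : ∃ v, ∀ i, S i v := by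
  classical
  have := Fintype.ofFinite ι
  have key (s : Finset ι) :
      LineGeneric (fun v => ∀ i ∈ s, S i v) ∧ ∃ v, ∀ i ∈ s, S i v := by
    induction s using Finset.induction_on with
    | empty => exact ⟨fun v w _ => by simp, 0, by simp⟩
    | insert a s _ ih =>
      simp only [Finset.forall_mem_insert]
      exact ⟨(hS a).and ih.1, (hS a).exists_and ih.1 (h a) ih.2⟩
  simpa using (key Finset.univ).2

/-- Stands in for a perturbation argument: the limit `t = 0` is checked, and some `t > 0` inherits
the property. -/
theorem LineGeneric.exists_ne_zero {S : V → Prop} (hS : LineGeneric S) {v : V} (hv : S v) (w : V) :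
    ∃ t : ℝ, 0 < t ∧ S (v + t • w) := by
  obtain ⟨t, ht, ht'⟩ := (Set.Ioi_infinite (0 : ℝ)).exists_notMem_finite (hS v (v + w) hv)
  refine ⟨t, ht, ?_⟩
  simp only [Set.mem_ofPred_eq, not_not] at ht'
  convert ht' using 1
  module

theorem lineGeneric_injective [Module.Finite ℝ V] :
    LineGeneric fun T : V →ₗ[ℝ] W => Function.Injective T := by
  intro T T' hT
  obtain ⟨R, hR⟩ := LinearMap.exists_leftInverse_of_injective T (LinearMap.ker_eq_bot.2 hT)
  refine (finite_setOf_not_bijective (ι := Unit) (fun _ => 1) (fun _ => 1) (fun _ => 1)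
    (R ∘ₗ T) (R ∘ₗ T') (by simp [hR]; rfl)).subset fun t ht hb => ht ?_
  have : (∑ _i : Unit, 1 * ((1 - t) • R ∘ₗ T + t • R ∘ₗ T') ^ 1 * 1 : Module.End ℝ V)
      = R ∘ₗ ((1 - t) • T + t • T') := by
    ext; simp
  rw [this, LinearMap.coe_comp] at hb
  exact hb.1.of_comp

theorem isObservable_iff {C : X →ₗ[ℝ] Y} {A : X →ₗ[ℝ] X} :
    IsObservable C A ↔
      Function.Injective (LinearMap.pi fun j : Fin (Module.finrank ℝ X) => C ∘ₗ A ^ (j : ℕ)) := by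
  rw [IsObservable, ← LinearMap.ker_pi, LinearMap.ker_eq_bot]

theorem controllableSubspace_eq_range (A : X →ₗ[ℝ] X) (B : U →ₗ[ℝ] X) (k : ℕ) :
    controllableSubspace A B k = LinearMap.range
      (LinearMap.lsum ℝ (fun _ : Fin k => U) ℝ fun j => (A ^ (j : ℕ)) ∘ₗ B) := by
  rw [controllableSubspace, LinearMap.range_eq_map, ← LinearMap.iSup_range_single ℝ,
    Submodule.map_iSup]
  refine iSup_congr fun j => ?_
  rw [← LinearMap.range_comp]
  congr 1
  ext u
  simp [LinearMap.lsum_apply, Pi.single_apply, apply_ite]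

theorem lineGeneric_controllableSubspace [Module.Finite ℝ X] (B : U →ₗ[ℝ] X) (k : ℕ) :
    LineGeneric fun A : X →ₗ[ℝ] X => controllableSubspace A B k = ⊤ := by
  intro A A' hA
  simp only [controllableSubspace_eq_range] at hA
  obtain ⟨R, hR⟩ := LinearMap.exists_rightInverse_of_surjective _ hA
  refine (finite_setOf_not_bijective (ι := Fin k) (fun _ => 1)
    (fun j => B ∘ₗ LinearMap.proj j ∘ₗ R) (fun j => j) A A' ?_).subset fun t ht hb => ht ?_
  · refine Eq.trans ?_ hR
    ext x
    simp [LinearMap.lsum_apply]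
  · have : (∑ j : Fin k, 1 * ((1 - t) • A + t • A') ^ (j : ℕ) * (B ∘ₗ LinearMap.proj j ∘ₗ R) :
        Module.End ℝ X) = (LinearMap.lsum ℝ (fun _ : Fin k => U) ℝ
          fun j => (((1 - t) • A + t • A') ^ (j : ℕ)) ∘ₗ B) ∘ₗ R := by
      ext x
      simp [LinearMap.lsum_apply]
    rw [this, LinearMap.coe_comp] at hb
    change controllableSubspace _ _ _ = ⊤
    rw [controllableSubspace_eq_range, LinearMap.range_eq_top]
    exact hb.2.of_comp

theorem lineGeneric_isObservable [Module.Finite ℝ X] (C : X →ₗ[ℝ] Y) :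
    LineGeneric fun A : X →ₗ[ℝ] X => IsObservable C A := by
  intro A A' hA
  rw [isObservable_iff] at hA
  obtain ⟨R, hR⟩ := LinearMap.exists_leftInverse_of_injective _ (LinearMap.ker_eq_bot.2 hA)
  have key (D : X →ₗ[ℝ] X) :
      (∑ j : Fin (Module.finrank ℝ X), (R ∘ₗ LinearMap.single ℝ _ j ∘ₗ C) * D ^ (j : ℕ) * 1 :
        Module.End ℝ X) = R ∘ₗ LinearMap.pi fun j => C ∘ₗ D ^ (j : ℕ) := by
    ext x
    simp only [mul_one, LinearMap.sum_apply, Module.End.mul_apply, LinearMap.comp_apply,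
      LinearMap.coe_single]
    rw [← map_sum]
    congr 1
    ext j
    simp [Finset.sum_apply, Pi.single_apply]
  refine (finite_setOf_not_bijective (fun j => R ∘ₗ LinearMap.single ℝ _ j ∘ₗ C)
    (fun _ => 1) (fun j => j) A A' ?_).subset fun t ht hb => ht ?_
  · rw [key, hR]; rfl
  · rw [key, LinearMap.coe_comp] at hb
    exact isObservable_iff.2 hb.1.of_comp

/-- Cayley–Hamilton: reduce the power modulo the characteristic polynomial. -/
theorem exists_pow_eq_sum [Module.Finite ℝ X] (A : X →ₗ[ℝ] X) (k : ℕ) :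
    ∃ c : Fin (Module.finrank ℝ X) → ℝ, A ^ k = ∑ l, c l • A ^ (l : ℕ) := by
  rcases subsingleton_or_nontrivial X with hX | hX
  · exact ⟨0, Subsingleton.elim _ _⟩
  refine ⟨fun l => ((Polynomial.X : ℝ[X]) ^ k %ₘ A.charpoly).coeff l, ?_⟩
  rw [LinearMap.pow_eq_aeval_mod_charpoly, aeval_eq_sum_range' (n := Module.finrank ℝ X),
    Finset.sum_range]
  rw [← LinearMap.charpoly_natDegree A]
  refine natDegree_modByMonic_lt _ A.charpoly_monic fun h1 => ?_
  have := LinearMap.charpoly_natDegree A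
  rw [h1, natDegree_one] at this
  exact Module.finrank_pos.ne this

theorem isObservable_of_forall [Module.Finite ℝ X] {C : X →ₗ[ℝ] Y} {A : X →ₗ[ℝ] X}
    (h : ∀ x, (∀ j : ℕ, C ((A ^ j) x) = 0) → x = 0) : IsObservable C A := by
  rw [isObservable_iff, ← LinearMap.ker_eq_bot, LinearMap.ker_eq_bot']
  intro x hx
  refine h x fun j => ?_
  obtain ⟨c, hc⟩ := exists_pow_eq_sum A j
  rw [hc]
  simp only [LinearMap.sum_apply, map_sum, LinearMap.smul_apply, map_smul]
  refine Finset.sum_eq_zero fun i _ => ?_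
  have := congrFun hx i
  simp only [LinearMap.pi_apply, LinearMap.comp_apply, Pi.zero_apply] at this
  rw [this, smul_zero]

theorem IsObservable.eq_zero {C : X →ₗ[ℝ] Y} {A : X →ₗ[ℝ] X} (h : IsObservable C A) {x : X}
    (hx : ∀ j : ℕ, C ((A ^ j) x) = 0) : x = 0 :=
  isObservable_iff.1 h (by ext j; simp [hx])

end Genericity

/-! ### Controllable and observable weighted graph Laplacians -/

section Laplacian

theorem exists_depth_of_reachable {ι : Type*} {r : ι → ι → Prop} (q : ι)
    (hr : ∀ i, Relation.ReflTransGen r q i) :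
    ∃ (d : ι → ℕ) (par : ι → ι), ∀ i, i ≠ q → r (par i) i ∧ d (par i) < d i := by
  classical
  -- `R n` is reachability from `q` by a walk of `n` arcs, so `d` is the distance from `q` and a
  -- parent is the penultimate vertex of a shortest walk.
  let R : ℕ → ι → Prop := fun n => Nat.rec (fun i => i = q) (fun _ P i => ∃ j, P j ∧ r j i) n
  have hR (i) : ∃ n, R n i := by
    induction hr i with
    | refl => exact ⟨0, rfl⟩
    | tail _ hjk ih =>
      obtain ⟨n, hn⟩ := ih
      exact ⟨n + 1, _, hn, hjk⟩
  let d : ι → ℕ := fun i => sInf {n | R n i}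
  have hpar (i : ι) : ∃ j : ι, i ≠ q → r j i ∧ d j < d i := by
    by_cases hi : i = q
    · exact ⟨i, fun h => absurd hi h⟩
    · have hs : R (d i) i := Nat.sInf_mem (hR i)
      cases hn : d i with
      | zero => rw [hn] at hs; exact absurd hs hi
      | succ n =>
        rw [hn] at hs
        obtain ⟨j, hj, hji⟩ := hs
        exact ⟨j, fun _ => ⟨hji, Nat.lt_succ_of_le (Nat.sInf_le hj)⟩⟩
  choose par hpar using hpar
  exact ⟨d, par, hpar⟩

variable {ι : Type*} [Fintype ι] {E : Type*} [AddCommGroup E] [Module ℝ E]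

/-- The weighted graph Laplacian `z ↦ (∑ j, h i j • (z i - z j))_i`. -/
def laplacian (E : Type*) [AddCommGroup E] [Module ℝ E] (h : ι → ι → ℝ) :
    (ι → E) →ₗ[ℝ] (ι → E) where
  toFun z i := ∑ j, h i j • (z i - z j)
  map_add' z w := by
    ext1 i
    simp only [Pi.add_apply, add_sub_add_comm, smul_add, Finset.sum_add_distrib]
  map_smul' c z := by
    ext1 i
    simp only [Pi.smul_apply, ← smul_sub, Finset.smul_sum, RingHom.id_apply, smul_comm c]

theorem laplacian_apply (h : ι → ι → ℝ) (z : ι → E) (i : ι) :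
    laplacian E h z i = ∑ j, h i j • (z i - z j) := rfl

theorem laplacian_smul (c : ℝ) (h : ι → ι → ℝ) : laplacian E (c • h) = c • laplacian E h := by
  ext1 z
  ext1 i
  simp [laplacian_apply, Finset.smul_sum, mul_smul]

theorem laplacian_add (g h : ι → ι → ℝ) :
    laplacian E (g + h) = laplacian E g + laplacian E h := by
  ext1 z
  ext1 i
  simp [laplacian_apply, Finset.sum_add_distrib, add_smul]

/-- The coordinates of a vertex-indexed family commute with the Laplacian. -/
theorem map_laplacian_pow_apply {E' : Type*} [AddCommGroup E'] [Module ℝ E'] (f : E →ₗ[ℝ] E')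
    (h : ι → ι → ℝ) (k : ℕ) (z : ι → E) (i : ι) :
    f ((laplacian E h ^ k) z i) = (laplacian E' h ^ k) (fun j => f (z j)) i := by
  induction k generalizing z with
  | zero => rfl
  | succ k ih =>
    rw [pow_succ, pow_succ, Module.End.mul_apply, Module.End.mul_apply, ih]
    refine congrFun (congrArg _ (funext fun j => ?_)) i
    simp [laplacian_apply]

variable [DecidableEq ι]

/-- From a vertex with a depth function decreasing along chosen parents, there is a Laplacian
weight, supported on the parent arcs, that makes the system controllable from the root. -/
theorem exists_controllable_laplacian_of_tree (q : ι) (d : ι → ℕ) (par : ι → ι)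
    (hd : ∀ i, i ≠ q → d (par i) < d i) :
    ∃ h : ι → ι → ℝ, (∀ i j, 0 ≤ h i j) ∧ (∀ i j, h i j ≠ 0 → i ≠ q ∧ j = par i) ∧
      controllableSubspace (laplacian ℝ h) (LinearMap.single ℝ (fun _ : ι => ℝ) q)
        (Fintype.card ι) = ⊤ := by
  let e := Fintype.equivFin ι
  -- These become the eigenvalues: `L` is triangular with respect to depth, with diagonal `a`.
  -- Distinctness makes the spectrum simple; the value 0 removes the arcs into the root.
  let a : ι → ℝ := fun i => if i = q then 0 else (e i : ℝ) + 1
  have haq : a q = 0 := if_pos rfl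
  have hai {i} (hi : i ≠ q) : a i = (e i : ℝ) + 1 := if_neg hi
  have hpos {i} (hi : i ≠ q) : 0 < a i := by rw [hai hi]; positivity
  have hinj : Function.Injective a := by
    intro i j hij
    by_cases hi : i = q <;> by_cases hj : j = q
    · rw [hi, hj]
    · subst hi; rw [haq] at hij; exact absurd hij (hpos hj).ne
    · subst hj; rw [haq] at hij; exact absurd hij (hpos hi).ne'
    · rw [hai hi, hai hj] at hij
      have : (e i : ℕ) = e j := by exact_mod_cast add_right_cancel hij
      exact e.injective (Fin.ext this)
  let h : ι → ι → ℝ := fun i j => if j = par i then a i else 0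
  let L := laplacian ℝ h
  have hL (z : ι → ℝ) (i : ι) : L z i = a i * (z i - z (par i)) := by
    simp [L, h, laplacian_apply]
  -- resolvent rows along the path to the root
  have hres (l : ℝ) : ∀ N j, d j < N → (∀ i, d i < N → a i ≠ l) →
      ∃ u : ι → ℝ, u q ≠ 0 ∧ ∀ z, ∑ i, u i * (L z i - l * z i) = z j := by
    intro N
    induction N with
    | zero => intro j hj; omega
    | succ N ih =>
      intro j hj hl
      have hjl : a j - l ≠ 0 := sub_ne_zero.2 (hl j hj)
      by_cases hjq : j = q
      · subst hjq
        refine ⟨Pi.single j (a j - l)⁻¹, by simpa using hjl, fun z => ?_⟩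
        simp only [Pi.single_apply, ite_mul, zero_mul, Finset.sum_ite_eq', Finset.mem_univ,
          if_true, hL, haq]
        rw [haq] at hjl
        field_simp
        ring
      -- Row `j` of `L - l` is `(a j - l) z j - a j z (par j)`; solve it for `z j` and insert the
      -- functional found for the parent.
      · obtain ⟨u, huq, hu⟩ := ih (par j) (by have := hd j hjq; omega)
          fun i hi => hl i (by omega)
        refine ⟨fun i => (a j - l)⁻¹ * (Pi.single (M := fun _ => ℝ) j 1 i + a j * u i), ?_, fun z => ?_⟩
        · have : Pi.single (M := fun _ => ℝ) j 1 q = 0 := Pi.single_eq_of_ne (Ne.symm hjq) _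
          simp only [this, zero_add]
          exact mul_ne_zero (inv_ne_zero hjl) (mul_ne_zero (hpos hjq).ne' huq)
        · have : ∀ i, (a j - l)⁻¹ * (Pi.single (M := fun _ => ℝ) j 1 i + a j * u i) *
              (L z i - l * z i) = (a j - l)⁻¹ * (Pi.single (M := fun _ => ℝ) j 1 i *
              (L z i - l * z i) + a j * (u i * (L z i - l * z i))) := fun i => by ring
          simp only [this]
          rw [← Finset.mul_sum, Finset.sum_add_distrib, ← Finset.mul_sum, hu]
          simp only [Pi.single_apply, ite_mul, zero_mul, one_mul, Finset.sum_ite_eq',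
            Finset.mem_univ, if_true, hL]
          field_simp
          ring
  -- A left eigenvector for `a k` is the coordinate at `k` plus `a k` times the resolvent row of
  -- `par k`. That row exists because vertices of depth below `d k` have weights other than `a k`.
  have heig (k : ι) : ∃ w : ι → ℝ, w q ≠ 0 ∧ ∀ z, ∑ i, w i * L z i = a k * ∑ i, w i * z i := by
    by_cases hk : k = q
    · subst hk
      refine ⟨Pi.single k 1, by simp, fun z => ?_⟩
      simp [Pi.single_apply, hL, haq]
    · obtain ⟨u, huq, hu⟩ := hres (a k) (d k) (par k) (hd k hk) fun i hi hik =>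
        by rw [hinj hik] at hi; omega
      refine ⟨fun i => Pi.single (M := fun _ => ℝ) k 1 i + a k * u i, ?_, fun z => ?_⟩
      · have : Pi.single (M := fun _ => ℝ) k 1 q = 0 := Pi.single_eq_of_ne (Ne.symm hk) _
        simp only [this, zero_add]
        exact mul_ne_zero (hpos hk).ne' huq
      · rw [← sub_eq_zero, Finset.mul_sum, ← Finset.sum_sub_distrib]
        have : ∀ i, (Pi.single (M := fun _ => ℝ) k 1 i + a k * u i) * L z i -
            a k * ((Pi.single (M := fun _ => ℝ) k 1 i + a k * u i) * z i) =
            Pi.single (M := fun _ => ℝ) k 1 i * (L z i - a k * z i) +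
            a k * (u i * (L z i - a k * z i)) := fun i => by ring
        simp only [this]
        rw [Finset.sum_add_distrib, ← Finset.mul_sum, hu]
        simp only [Pi.single_apply, ite_mul, zero_mul, one_mul, Finset.sum_ite_eq',
          Finset.mem_univ, if_true, hL]
        ring
  choose w hwq hw using heig
  have hwpow (k : ι) (j : ℕ) : ∑ i, w k i * (L ^ j) (Pi.single q 1) i = a k ^ j * w k q := by
    induction j with
    | zero => simp [Pi.single_apply]
    | succ j ih => rw [pow_succ', Module.End.mul_apply, hw, ih, pow_succ']; ring
  let n := Fintype.card ι
  let Wm : Matrix (Fin n) ι ℝ := Matrix.of fun k i => w (e.symm k) i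
  let Kr : Matrix ι (Fin n) ℝ := Matrix.of fun i j => (L ^ (j : ℕ)) (Pi.single q 1) i
  -- Left eigenvectors paired with the Krylov vectors of the root form a Vandermonde matrix with
  -- rows scaled by `w k q`.
  have hprod : Wm * Kr = Matrix.diagonal (fun k => w (e.symm k) q) *
      Matrix.vandermonde (fun k => a (e.symm k)) := by
    ext k j
    rw [Matrix.diagonal_mul, Matrix.vandermonde_apply, mul_comm, Matrix.mul_apply]
    exact hwpow _ _
  have hdet : IsUnit (Wm * Kr).det := by
    rw [hprod, Matrix.det_mul, Matrix.det_diagonal, isUnit_iff_ne_zero]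
    exact mul_ne_zero (Finset.prod_ne_zero_iff.2 fun k _ => hwq _)
      (Matrix.det_vandermonde_ne_zero_iff.2 (hinj.comp e.symm.injective))
  have hinjKr : Function.Injective Kr.mulVecLin := by
    have : Function.Injective ((Wm * Kr).mulVecLin) :=
      Matrix.mulVec_injective_iff_isUnit.2 ((Matrix.isUnit_iff_isUnit_det _).2 hdet)
    rw [Matrix.mulVecLin_mul, LinearMap.coe_comp] at this
    exact this.of_comp
  have hsurj : Function.Surjective Kr.mulVecLin :=
    (LinearMap.injective_iff_surjective_of_finrank_eq_finrank (by simp [n])).1 hinjKr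
  refine ⟨h, fun i j => ?_, fun i j hij => ?_, ?_⟩
  · by_cases hi : i = q
    · simp [h, hi, haq]
    · have := (hpos hi).le
      simp only [h]; split_ifs <;> simp [this]
  · simp only [h, ne_eq, ite_eq_right_iff, Classical.not_imp] at hij
    exact ⟨fun hi => hij.2 (by rw [hi, haq]), hij.1⟩
  · rw [controllableSubspace_eq_range, LinearMap.range_eq_top]
    intro f
    obtain ⟨c, hc⟩ := hsurj f
    refine ⟨c, ?_⟩
    rw [← hc]
    ext i
    have (j : Fin n) : (Pi.single q (c j) : ι → ℝ) = c j • Pi.single q 1 := by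
      rw [← Pi.single_smul', smul_eq_mul, mul_one]
    simp [LinearMap.lsum_apply, Kr, Matrix.mulVec, dotProduct, this, L, mul_comm, n]

/-- On a strongly connected graph there are positive arc weights for which the Laplacian system is
controllable from a given vertex. -/
theorem exists_controllable_laplacian {r : ι → ι → Prop} (q : ι)
    (hr : ∀ i, Relation.ReflTransGen r q i) :
    ∃ h : ι → ι → ℝ, (∀ i j, 0 ≤ h i j) ∧ (∀ i j, h i j ≠ 0 ↔ r j i) ∧
      controllableSubspace (laplacian ℝ h) (LinearMap.single ℝ (fun _ : ι => ℝ) q)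
        (Fintype.card ι) = ⊤ := by
  classical
  obtain ⟨d, par, hd⟩ := exists_depth_of_reachable q hr
  obtain ⟨h, h0, hs, hc⟩ := exists_controllable_laplacian_of_tree q d par fun i hi => (hd i hi).2
  -- Adding `t > 0` times the unit-weight Laplacian makes the weight of every arc positive.
  obtain ⟨t, ht, hct⟩ := (lineGeneric_controllableSubspace (LinearMap.single ℝ (fun _ : ι => ℝ) q)
    (Fintype.card ι)).exists_ne_zero hc (laplacian ℝ fun i j => if r j i then 1 else 0)
  rw [← laplacian_smul, ← laplacian_add] at hct
  refine ⟨_, fun i j => ?_, fun i j => ?_, hct⟩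
  · have := h0 i j
    simp only [Pi.add_apply, Pi.smul_apply, smul_eq_mul]
    split_ifs <;> nlinarith
  · have := h0 i j
    simp only [Pi.add_apply, Pi.smul_apply, smul_eq_mul]
    by_cases hij : r j i
    · simp only [hij, if_true, iff_true]; nlinarith
    · simp only [hij, if_false, mul_zero, add_zero, iff_false, not_not]
      by_contra hne
      obtain ⟨hi, rfl⟩ := hs i j hne
      exact hij (hd i hi).1

/-- A strongly connected weighted Laplacian has a positive left null vector. -/
theorem exists_pos_left_null {r : ι → ι → Prop} (hr : ∀ i j, Relation.ReflTransGen r i j)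
    {h : ι → ι → ℝ} (h0 : ∀ i j, 0 ≤ h i j) (hs : ∀ i j, h i j ≠ 0 ↔ r j i) :
    ∃ π : ι → ℝ, (∀ i, 0 < π i) ∧ ∀ j, ∑ i, π i * h i j = π j * ∑ i, h j i := by
  rcases isEmpty_or_nonempty ι with hι | hι
  · exact ⟨fun _ => 1, by simp, fun j => (hι.false j).elim⟩
  let M : Matrix ι ι ℝ := Matrix.diagonal (fun i => ∑ j, h i j) - Matrix.of h
  have hM : M.det = 0 := by
    refine Matrix.exists_mulVec_eq_zero_iff.1 ⟨fun _ => 1, ?_, ?_⟩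
    · intro h1
      have := congrFun h1 (Classical.arbitrary ι)
      simp at this
    · ext i
      rw [Matrix.sub_mulVec, Pi.sub_apply, Matrix.mulVec_diagonal]
      simp [Matrix.mulVec, dotProduct]
  obtain ⟨w, hw0, hw⟩ := Matrix.exists_vecMul_eq_zero_iff.2 hM
  have hwj (j) : ∑ i, w i * h i j = w j * ∑ i, h j i := by
    have := congrFun hw j
    simp only [M, Matrix.vecMul_sub, Pi.sub_apply, Matrix.vecMul_diagonal, Pi.zero_apply] at this
    simp only [Matrix.vecMul, dotProduct, Matrix.of_apply] at this
    linarith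
  -- Both sides have the same total over `j`, so these inequalities are equalities and `|w|` is
  -- again a left null vector.
  have hle (j) : |w j| * ∑ i, h j i ≤ ∑ i, |w i| * h i j := by
    have : |w j| * ∑ i, h j i = |w j * ∑ i, h j i| := by
      rw [abs_mul, abs_of_nonneg (Finset.sum_nonneg fun i _ => h0 j i)]
    rw [this, ← hwj]
    refine (Finset.abs_sum_le_sum_abs _ _).trans_eq (Finset.sum_congr rfl fun i _ => ?_)
    rw [abs_mul, abs_of_nonneg (h0 i j)]
  have hsum : ∑ j, |w j| * ∑ i, h j i = ∑ j, ∑ i, |w i| * h i j := by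
    rw [Finset.sum_comm]
    simp only [Finset.mul_sum]
  have heq (j) : |w j| * ∑ i, h j i = ∑ i, |w i| * h i j :=
    (Finset.sum_eq_sum_iff_of_le fun j _ => hle j).1 hsum j (Finset.mem_univ j)
  refine ⟨fun i => |w i|, fun i => ?_, fun j => (heq j).symm⟩
  rw [abs_pos]
  intro hi
  -- zeros propagate along arcs
  apply hw0
  ext k
  have key (j) (hij : Relation.ReflTransGen r i j) : w j = 0 := by
    induction hij with
    | refl => exact hi
    | @tail j k _ hjk ih =>
      have h1 := heq j
      rw [ih, abs_zero, zero_mul] at h1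
      have h2 := (Finset.sum_eq_zero_iff_of_nonneg fun i _ =>
        mul_nonneg (abs_nonneg (w i)) (h0 i j)).1 h1.symm k (Finset.mem_univ k)
      rcases mul_eq_zero.1 h2 with h3 | h3
      · exact abs_eq_zero.1 h3
      · exact absurd h3 ((hs k j).2 hjk)
  exact key k (hr i k)

/-- On a strongly connected graph there are arc weights with a positive left null vector of the
Laplacian for which the Laplacian is observable at a given vertex. -/
theorem exists_observable_laplacian {r : ι → ι → Prop} (hr : ∀ i j, Relation.ReflTransGen r i j)
    (q : ι) :
    ∃ (h : ι → ι → ℝ) (π : ι → ℝ), (∀ i j, h i j ≠ 0 → r j i) ∧ (∀ i, 0 < π i) ∧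
      (∀ v : ι → ℝ, ∑ i, π i * laplacian ℝ h v i = 0) ∧
      ∀ v : ι → ℝ, (∀ k : ℕ, (laplacian ℝ h ^ k) v q = 0) → v = 0 := by
  have hr' (i j) : Relation.ReflTransGen (Function.swap r) i j :=
    Relation.reflTransGen_swap.2 (hr j i)
  obtain ⟨h', h0, hs, hc⟩ := exists_controllable_laplacian q (hr' q)
  obtain ⟨π, hπ, hπh⟩ := exists_pos_left_null hr' h0 hs
  -- The adjoint of `h'` in the inner product weighted by `π`; it is again a Laplacian because `π`
  -- is a left null vector of `h'`.
  let h : ι → ι → ℝ := fun i j => π j * h' j i / π i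
  have hadj (u v : ι → ℝ) : ∑ i, π i * (laplacian ℝ h v i * u i) =
      ∑ i, π i * (v i * laplacian ℝ h' u i) := by
    have h1 (i) : π i * (laplacian ℝ h v i * u i) =
        π i * v i * u i * ∑ j, h' i j - ∑ j, u i * π j * h' j i * v j := by
      have : π i * laplacian ℝ h v i = v i * ∑ j, π j * h' j i - ∑ j, π j * h' j i * v j := by
        rw [laplacian_apply, Finset.mul_sum, Finset.mul_sum, ← Finset.sum_sub_distrib]
        refine Finset.sum_congr rfl fun j _ => ?_
        have := (hπ i).ne'
        simp only [h, smul_eq_mul]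
        field_simp
      rw [← mul_assoc, this, hπh, sub_mul, Finset.sum_mul]
      congr 1
      · ring
      · exact Finset.sum_congr rfl fun j _ => by ring
    have h2 (i) : π i * (v i * laplacian ℝ h' u i) =
        π i * v i * u i * ∑ j, h' i j - ∑ j, u j * π i * h' i j * v i := by
      rw [laplacian_apply, Finset.mul_sum, Finset.mul_sum, Finset.mul_sum,
        ← Finset.sum_sub_distrib]
      exact Finset.sum_congr rfl fun j _ => by simp only [smul_eq_mul]; ring
    simp only [h1, h2, Finset.sum_sub_distrib]
    congr 1
    exact Finset.sum_comm
  have hadjk (k : ℕ) (u v : ι → ℝ) : ∑ i, π i * ((laplacian ℝ h ^ k) v i * u i) =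
      ∑ i, π i * (v i * (laplacian ℝ h' ^ k) u i) := by
    induction k generalizing u v with
    | zero => rfl
    | succ k ih => rw [pow_succ, Module.End.mul_apply, ih, hadj, pow_succ', Module.End.mul_apply]
  refine ⟨h, π, fun i j hij => ?_, hπ, fun v => ?_, fun v hv => ?_⟩
  · refine (hs j i).1 fun h1 => hij ?_
    simp [h, h1]
  · have := hadj (fun _ => 1) v
    simpa [laplacian_apply] using this
  · rw [controllableSubspace_eq_range, LinearMap.range_eq_top] at hc
    obtain ⟨c, hc⟩ := hc v
    -- Expand one factor `v` in the Krylov vectors of `h'` and move the powers to the other: only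
    -- the values at `q`, all zero, remain.
    have hz : ∑ i, π i * (v i * v i) = 0 := by
      have hvi (i : ι) : v i = ∑ k : Fin (Fintype.card ι),
          (laplacian ℝ h' ^ (k : ℕ)) (Pi.single q (c k)) i := by
        have := congrFun hc i
        simpa [LinearMap.lsum_apply, eq_comm] using this
      have hvv (i : ι) : π i * (v i * v i) = ∑ k : Fin (Fintype.card ι),
          π i * (v i * (laplacian ℝ h' ^ (k : ℕ)) (Pi.single q (c k)) i) := by
        rw [← Finset.mul_sum, ← Finset.mul_sum, ← hvi]
      simp only [hvv]
      rw [Finset.sum_comm]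
      refine Finset.sum_eq_zero fun k _ => ?_
      rw [← hadjk]
      simp [Pi.single_apply, hv]
    ext i
    have := (Finset.sum_eq_zero_iff_of_nonneg fun i _ =>
      mul_nonneg (hπ i).le (mul_self_nonneg (v i))).1 hz i (Finset.mem_univ i)
    simpa [(hπ i).ne'] using this

/-- The `E`-valued Laplacian is the scalar one tensored with the identity, so the scalar
coefficients that produce the standard basis vectors serve for `E` as well. -/
theorem controllableSubspace_laplacian_eq_top {h : ι → ι → ℝ} {q : ι} {k : ℕ}
    (hc : controllableSubspace (laplacian ℝ h) (LinearMap.single ℝ (fun _ : ι => ℝ) q) k = ⊤) :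
    controllableSubspace (laplacian E h) (LinearMap.single ℝ (fun _ : ι => E) q) k = ⊤ := by
  rw [controllableSubspace_eq_range, LinearMap.range_eq_top] at hc ⊢
  choose c hc using hc
  have hc' (l i : ι) : ∑ j : Fin k, c (Pi.single l 1) j *
      (laplacian ℝ h ^ (j : ℕ)) (Pi.single q 1) i = Pi.single (M := fun _ => ℝ) l 1 i := by
    have hl := congrFun (hc (Pi.single l 1)) i
    have (j : Fin k) : (Pi.single q (c (Pi.single l 1) j) : ι → ℝ) =
        c (Pi.single l 1) j • Pi.single q 1 := by
      rw [← Pi.single_smul', smul_eq_mul, mul_one]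
    simpa [LinearMap.lsum_apply, this] using hl
  have hE (j : ℕ) (u : E) (i : ι) : (laplacian E h ^ j) (Pi.single q u) i =
      (laplacian ℝ h ^ j) (Pi.single q 1) i • u := by
    have := map_laplacian_pow_apply (LinearMap.toSpanSingleton ℝ E u) h j (Pi.single q 1) i
    rw [LinearMap.toSpanSingleton_apply] at this
    rw [this]
    refine congrFun (congrArg _ (funext fun l => ?_)) i
    by_cases hl : l = q
    · subst hl; simp
    · simp [Pi.single_eq_of_ne hl]
  intro f
  refine ⟨fun j => ∑ l, c (Pi.single l 1) j • f l, ?_⟩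
  ext1 i
  simp only [LinearMap.lsum_apply, LinearMap.sum_apply, LinearMap.comp_apply,
    LinearMap.proj_apply, LinearMap.coe_single, Finset.sum_apply, hE, Finset.smul_sum, smul_smul]
  rw [Finset.sum_comm]
  simp only [← Finset.sum_smul, mul_comm _ (c _ _), hc']
  simp [Pi.single_apply]

end Laplacian

/-! ### Observability of a fast network driven by a slow system -/

section Cascade

variable {ι : Type*} {E Y : Type*} [AddCommGroup E] [Module ℝ E]
  [AddCommGroup Y] [Module ℝ Y]

/-- The output of a cascade: `c` of the driving state, and the network states in `s`. -/
def cascadeOutput (c : E →ₗ[ℝ] Y) (s : Finset ι) :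
    (E × (ι → E)) →ₗ[ℝ] Y × ({j // j ∈ s} → E) :=
  LinearMap.prod (c ∘ₗ LinearMap.fst ℝ _ _)
    (LinearMap.pi fun j => LinearMap.proj j.1 ∘ₗ LinearMap.snd ℝ _ _)

theorem cascadeOutput_eq_zero_iff {c : E →ₗ[ℝ] Y} {s : Finset ι} {u : E × (ι → E)} :
    cascadeOutput c s u = 0 ↔ c u.1 = 0 ∧ ∀ j ∈ s, u.2 j = 0 := by
  rw [cascadeOutput, LinearMap.prod_apply, Prod.ext_iff]
  simp [funext_iff]

variable [Fintype ι]

theorem sum_smul_laplacian_eq_zero {h : ι → ι → ℝ} {π : ι → ℝ}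
    (hπ : ∀ v : ι → ℝ, ∑ i, π i * laplacian ℝ h v i = 0) (z : ι → E) :
    ∑ i, π i • laplacian E h z i = 0 := by
  rw [← Module.forall_dual_apply_eq_zero_iff ℝ]
  intro f
  rw [map_sum, ← hπ fun j => f (z j)]
  refine Finset.sum_congr rfl fun i _ => ?_
  rw [map_smul, smul_eq_mul]
  congr 1
  simpa using map_laplacian_pow_apply f h 1 z i

theorem eq_zero_of_laplacian_pow_apply_eq_zero {h : ι → ι → ℝ} {q : ι}
    (hobs : ∀ v : ι → ℝ, (∀ k : ℕ, (laplacian ℝ h ^ k) v q = 0) → v = 0) {z : ι → E}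
    (hz : ∀ k : ℕ, (laplacian E h ^ k) z q = 0) : z = 0 := by
  ext1 i
  rw [Pi.zero_apply, ← Module.forall_dual_apply_eq_zero_iff ℝ]
  intro f
  refine congrFun (hobs (fun j => f (z j)) fun k => ?_) i
  rw [← map_laplacian_pow_apply, hz, map_zero]

theorem laplacian_apply_eq_zero {h : ι → ι → ℝ} {q : ι} {z : ι → E} (hq : z q = 0)
    (hz : ∀ j, h q j ≠ 0 → z j = 0) : laplacian E h z q = 0 := by
  rw [laplacian_apply]
  refine Finset.sum_eq_zero fun j _ => ?_
  by_cases hj : h q j = 0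
  · rw [hj, zero_smul]
  · rw [hq, hz j hj, sub_zero, smul_zero]

/-- A Laplacian network of copies of `b`, relative to the vertex `q`, driven by the autonomous
system `a` through the maps `κ`. -/
def cascade (a b : E →ₗ[ℝ] E) (κ : ι → E →ₗ[ℝ] E) (h : ι → ι → ℝ) (q : ι) :
    (E × (ι → E)) →ₗ[ℝ] (E × (ι → E)) :=
  LinearMap.prod (a ∘ₗ LinearMap.fst ℝ _ _) (LinearMap.pi fun i =>
    b ∘ₗ LinearMap.proj i ∘ₗ LinearMap.snd ℝ _ _ +
    ((LinearMap.proj i : (ι → E) →ₗ[ℝ] E) - (LinearMap.proj q : (ι → E) →ₗ[ℝ] E)) ∘ₗ laplacian E h ∘ₗ LinearMap.snd ℝ _ _ +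
    (κ i - κ q) ∘ₗ LinearMap.fst ℝ _ _)

theorem cascade_fst (a b : E →ₗ[ℝ] E) (κ : ι → E →ₗ[ℝ] E) (h : ι → ι → ℝ) (q : ι)
    (u : E × (ι → E)) : (cascade a b κ h q u).1 = a u.1 := rfl

theorem cascade_snd (a b : E →ₗ[ℝ] E) (κ : ι → E →ₗ[ℝ] E) (h : ι → ι → ℝ) (q : ι)
    (u : E × (ι → E)) (i : ι) : (cascade a b κ h q u).2 i =
      b (u.2 i) + (laplacian E h u.2 i - laplacian E h u.2 q) + (κ i u.1 - κ q u.1) := rfl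

theorem cascade_pow_fst (a b : E →ₗ[ℝ] E) (κ : ι → E →ₗ[ℝ] E) (h : ι → ι → ℝ) (q : ι)
    (k : ℕ) (u : E × (ι → E)) : ((cascade a b κ h q ^ k) u).1 = (a ^ k) u.1 := by
  induction k with
  | zero => rfl
  | succ k ih => rw [pow_succ', pow_succ', Module.End.mul_apply, Module.End.mul_apply,
      cascade_fst, ih]

variable {a b : E →ₗ[ℝ] E} {κ : ι → E →ₗ[ℝ] E} {c : E →ₗ[ℝ] Y} {h : ι → ι → ℝ} {q : ι}
  {s : Finset ι}

/-- Zero output at `q` and its neighbours kills `L z` at `q`. With zero drive, `L z` is then a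
multiple of the network part of `M u` minus `b z`. Since `M u` is also unobserved and `b` commutes
with `L`, induction annihilates all `L ^ k z` on `s`. -/
theorem snd_eq_zero_of_cascadeOutput_eq_zero (hq : q ∈ s) (hs : ∀ j, h q j ≠ 0 → j ∈ s)
    (hobs : ∀ v : ι → ℝ, (∀ k : ℕ, (laplacian ℝ h ^ k) v q = 0) → v = 0) {t : ℝ} (ht : t ≠ 0)
    {u : E × (ι → E)} (hu1 : u.1 = 0)
    (hu : ∀ k : ℕ, cascadeOutput c s ((cascade a b κ (t⁻¹ • h) q ^ k) u) = 0) : u.2 = 0 := by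
  set M := cascade a b κ (t⁻¹ • h) q with hM
  have key (k : ℕ) : ∀ u : E × (ι → E), u.1 = 0 → (∀ k : ℕ, cascadeOutput c s ((M ^ k) u) = 0) →
      ∀ j ∈ s, (laplacian E h ^ k) u.2 j = 0 := by
    induction k with
    | zero => intro u _ hu; exact (cascadeOutput_eq_zero_iff.1 (hu 0)).2
    | succ k ih =>
      intro u hu1 hu j hj
      have hz := (cascadeOutput_eq_zero_iff.1 (hu 0)).2
      have hLq : laplacian E h u.2 q = 0 :=
        laplacian_apply_eq_zero (hz q hq) fun j hj => hz j (hs j hj)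
      have hL : laplacian E h u.2 = t • ((M u).2 - fun i => b (u.2 i)) := by
        ext1 i
        simp only [hM, Pi.smul_apply, Pi.sub_apply, cascade_snd, hu1, laplacian_smul,
          LinearMap.smul_apply, hLq, map_zero, sub_zero, add_zero, smul_zero,
          add_sub_cancel_left, smul_smul, mul_inv_cancel₀ ht, one_smul]
      rw [pow_succ, Module.End.mul_apply, hL, map_smul, map_sub, Pi.smul_apply, Pi.sub_apply,
        ih (M u) (by rw [hM, cascade_fst, hu1, map_zero]) (fun l => ?_) j hj,
        ← map_laplacian_pow_apply b, ih u hu1 hu j hj, map_zero, sub_zero, smul_zero]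
      rw [← Module.End.mul_apply, ← pow_succ]
      exact hu _
  exact eq_zero_of_laplacian_pow_apply_eq_zero hobs fun k => key k u hu1 hu q hq

/-- If the driving system is observable through `c` together with the weighted sum of the driving
maps, then the cascade with a fast network is observable. -/
theorem exists_isObservable_cascade [Module.Finite ℝ E] (hq : q ∈ s)
    (hs : ∀ j, h q j ≠ 0 → j ∈ s)
    (hobs : ∀ v : ι → ℝ, (∀ k : ℕ, (laplacian ℝ h ^ k) v q = 0) → v = 0)
    {π : ι → ℝ} (hπ : ∀ v : ι → ℝ, ∑ i, π i * laplacian ℝ h v i = 0)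
    (hκq : ∀ x, c x = 0 → κ q x = 0)
    (hκ : ∀ x, (∀ j < Module.finrank ℝ E, c ((a ^ j) x) = 0 ∧ ∑ i, π i • κ i ((a ^ j) x) = 0) →
      x = 0) :
    ∃ t : ℝ, 0 < t ∧ IsObservable (cascadeOutput c s) (cascade a b (t⁻¹ • κ) (t⁻¹ • h) q) := by
  let N := Module.finrank ℝ E
  choose p hp using fun k => exists_pow_eq_sum a k
  -- The limit `t = 0` of `t` times the equations for the first `N` samples `ζ j` of an unobserved
  -- trajectory: the network is in equilibrium with its drive.
  let T0 : (E × (Fin N → ι → E)) →ₗ[ℝ]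
      ((Fin N → ι → E) × (Fin N → {j // j ∈ s} → E) × (Fin N → Y)) :=
    LinearMap.prod (LinearMap.pi fun j => LinearMap.pi fun i =>
        ((LinearMap.proj i : (ι → E) →ₗ[ℝ] E) - (LinearMap.proj q : (ι → E) →ₗ[ℝ] E)) ∘ₗ laplacian E h ∘ₗ LinearMap.proj j ∘ₗ
          LinearMap.snd ℝ _ _ + (κ i - κ q) ∘ₗ (a ^ (j : ℕ)) ∘ₗ LinearMap.fst ℝ _ _)
      (LinearMap.prod
        (LinearMap.pi fun j => LinearMap.pi fun l =>
          LinearMap.proj l.1 ∘ₗ LinearMap.proj j ∘ₗ LinearMap.snd ℝ _ _)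
        (LinearMap.pi fun j => c ∘ₗ (a ^ (j : ℕ)) ∘ₗ LinearMap.fst ℝ _ _))
  let pr (l : Fin N) (i : ι) : (E × (Fin N → ι → E)) →ₗ[ℝ] E :=
    (LinearMap.proj i : (ι → E) →ₗ[ℝ] E) ∘ₗ
      (LinearMap.proj l : (Fin N → ι → E) →ₗ[ℝ] (ι → E)) ∘ₗ LinearMap.snd ℝ _ _
  -- The terms of order `t`. Sample `j + 1` is written through the first `N` samples, which closes
  -- the system even at `j = N - 1`.
  let T1 : (E × (Fin N → ι → E)) →ₗ[ℝ]
      ((Fin N → ι → E) × (Fin N → {j // j ∈ s} → E) × (Fin N → Y)) :=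
    LinearMap.prod (LinearMap.pi fun j => LinearMap.pi fun i =>
        b ∘ₗ pr j i - ∑ l, p (j + 1) l • pr l i) 0
  have hT0 : Function.Injective T0 := by
    rw [← LinearMap.ker_eq_bot, LinearMap.ker_eq_bot']
    rintro ⟨x, ζ⟩ hx
    have h1 (j : Fin N) (i : ι) : laplacian E h (ζ j) i - laplacian E h (ζ j) q +
        (κ i ((a ^ (j : ℕ)) x) - κ q ((a ^ (j : ℕ)) x)) = 0 :=
      congrFun (congrFun (congrArg Prod.fst hx) j) i
    have h2 (j : Fin N) (l) (hl : l ∈ s) : ζ j l = 0 :=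
      congrFun (congrFun (congrArg (fun y => y.2.1) hx) j) ⟨l, hl⟩
    have h3 (j : Fin N) : c ((a ^ (j : ℕ)) x) = 0 :=
      congrFun (congrArg (fun y => y.2.2) hx) j
    have h4 (j : Fin N) : laplacian E h (ζ j) q = 0 :=
      laplacian_apply_eq_zero (h2 j q hq) fun l hl => h2 j l (hs l hl)
    simp only [h4, hκq _ (h3 _), sub_zero] at h1
    -- Summing the equilibrium equations against `π` removes the Laplacian and leaves the hypothesis
    -- of `hκ`.
    have hx0 : x = 0 := by
      refine hκ x fun j hj => ⟨h3 ⟨j, hj⟩, ?_⟩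
      have h5 : ∑ i, π i • (laplacian E h (ζ ⟨j, hj⟩) i + κ i ((a ^ j) x)) = 0 :=
        Finset.sum_eq_zero fun i _ => by rw [h1 ⟨j, hj⟩ i, smul_zero]
      simpa [smul_add, Finset.sum_add_distrib, sum_smul_laplacian_eq_zero hπ] using h5
    have hζ : ζ = 0 := by
      ext1 j
      refine eq_zero_of_laplacian_pow_apply_eq_zero hobs (q := q) fun k => ?_
      cases k with
      | zero => exact h2 j q hq
      | succ k =>
        have : laplacian E h (ζ j) = 0 := by
          ext1 i
          simpa [hx0] using h1 j i
        rw [pow_succ, Module.End.mul_apply, this, map_zero, Pi.zero_apply]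
    rw [hx0, hζ]; rfl
  obtain ⟨t, ht, hT⟩ := lineGeneric_injective.exists_ne_zero hT0 T1
  refine ⟨t, ht, isObservable_of_forall fun u hu => ?_⟩
  set M := cascade a b (t⁻¹ • κ) (t⁻¹ • h) q with hM
  -- The difference of the two sides comes from an unobserved state whose driving part vanishes by
  -- the choice of `p`, so its network part vanishes too.
  have hrec (k : ℕ) : ((M ^ k) u).2 = ∑ l, p k l • ((M ^ (l : ℕ)) u).2 := by
    have := snd_eq_zero_of_cascadeOutput_eq_zero (a := a) (b := b) (κ := t⁻¹ • κ) (c := c) hq hs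
      hobs ht.ne' (u := (M ^ k) u - ∑ l, p k l • (M ^ (l : ℕ)) u) ?_ fun j => ?_
    · rw [Prod.snd_sub, sub_eq_zero] at this
      rw [this, Prod.snd_sum]
      rfl
    · rw [Prod.fst_sub, Prod.fst_sum]
      simp only [Prod.smul_fst, hM, cascade_pow_fst]
      rw [hp k]
      simp
    · rw [← hM]
      simp only [map_sub, map_sum, map_smul, ← Module.End.mul_apply, ← pow_add, hu, smul_zero,
        Finset.sum_const_zero, sub_zero]
  have hker : (T0 + t • T1) (u.1, fun j => ((M ^ (j : ℕ)) u).2) = 0 := by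
    refine Prod.ext ?_ (Prod.ext ?_ ?_)
    · ext1 j
      ext1 i
      have h1 := congrFun (hrec (j + 1)) i
      rw [pow_succ', Module.End.mul_apply, hM, cascade_snd, ← hM, hM, cascade_pow_fst, ← hM,
        Finset.sum_apply] at h1
      simp only [laplacian_smul, LinearMap.smul_apply, Pi.smul_apply] at h1
      change (laplacian E h ((M ^ (j : ℕ)) u).2 i - laplacian E h ((M ^ (j : ℕ)) u).2 q +
        (κ i ((a ^ (j : ℕ)) u.1) - κ q ((a ^ (j : ℕ)) u.1))) + t • (b (((M ^ (j : ℕ)) u).2 i) -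
        (∑ l, p (j + 1) l • pr l i) (u.1, fun j => ((M ^ (j : ℕ)) u).2)) = 0
      have h2 : (∑ l, p (j + 1) l • pr l i) (u.1, fun j => ((M ^ (j : ℕ)) u).2) =
          ∑ l, p (j + 1) l • ((M ^ (l : ℕ)) u).2 i := by
        simp [LinearMap.sum_apply, pr]
      rw [h2, ← h1]
      simp only [smul_sub, smul_add, smul_smul, mul_inv_cancel₀ ht.ne', one_smul]
      abel
    · ext1 j
      ext1 l
      have := (cascadeOutput_eq_zero_iff.1 (hu j)).2 l.1 l.2
      change ((M ^ (j : ℕ)) u).2 l + t • (0 : E) = 0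
      rw [this, smul_zero, add_zero]
    · ext1 j
      have := (cascadeOutput_eq_zero_iff.1 (hu j)).1
      rw [hM, cascade_pow_fst] at this
      change c ((a ^ (j : ℕ)) u.1) + t • (0 : Y) = 0
      rw [this, smul_zero, add_zero]
  have hu1 : u.1 = 0 := congrArg Prod.fst (hT (hker.trans (map_zero _).symm))
  exact Prod.ext hu1 (snd_eq_zero_of_cascadeOutput_eq_zero hq hs hobs ht.ne' hu1 hu)

/-- Copies of `a`, with diffusive coupling by the Laplacian and by `∑ j, G j`, and weak local
feedback, can be observed at `q` through differences. -/
theorem exists_isObservable_network [Module.Finite ℝ E] {Z : Type*} [AddCommGroup Z] [Module ℝ Z]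
    (G : ι → E →ₗ[ℝ] E)
    (hobs : IsObservable (cascadeOutput c s) (cascade a (a + ∑ j, G j) κ h q))
    (O : (ι → E) →ₗ[ℝ] Z) (hO : ∀ e, O e = 0 → c (e q) = 0 ∧ ∀ j ∈ s, e q = e j) :
    ∃ t : ℝ, 0 < t ∧ ∀ D : (ι → E) →ₗ[ℝ] (ι → E), (∀ e i, D e i =
        a (e i) + t • κ i (e i) + laplacian E h e i + ∑ j, G j (e i - e j)) →
      IsObservable O D := by
  -- What remains, at order `t`, after subtracting the cascade from the dynamics in the coordinates
  -- `σ`.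
  let M1 : (E × (ι → E)) →ₗ[ℝ] (E × (ι → E)) := LinearMap.prod
    (κ q ∘ₗ LinearMap.fst ℝ _ _ + (LinearMap.proj q ∘ₗ laplacian E h -
      ∑ j, G j ∘ₗ LinearMap.proj j) ∘ₗ LinearMap.snd ℝ _ _)
    (LinearMap.pi fun i => κ i ∘ₗ LinearMap.proj i ∘ₗ LinearMap.snd ℝ _ _)
  have hM1 (u : E × (ι → E)) : M1 u = (κ q u.1 + (laplacian E h u.2 q - ∑ j, G j (u.2 j)),
      fun i => κ i (u.2 i)) := by
    refine Prod.ext ?_ rfl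
    simp [M1]
  obtain ⟨t, ht, hM⟩ := (lineGeneric_isObservable (cascadeOutput c s)).exists_ne_zero hobs M1
  refine ⟨t, ht, fun D hD => isObservable_of_forall fun e he => ?_⟩
  set M := cascade a (a + ∑ j, G j) κ h q + t • M1 with hMdef
  -- Magnifying the differences by `t⁻¹` lets the weak feedback `t • κ` drive them at order one,
  -- while their action back on `e q` becomes of order `t`.
  let σ : (ι → E) → E × (ι → E) := fun e => (e q, fun i => t⁻¹ • (e i - e q))
  have hLσ (e : ι → E) (i : ι) : laplacian E h (fun i => t⁻¹ • (e i - e q)) i =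
      t⁻¹ • laplacian E h e i := by
    simp only [laplacian_apply, ← smul_sub, sub_sub_sub_cancel_right, Finset.smul_sum]
    exact Finset.sum_congr rfl fun j _ => smul_comm _ _ _
  have hcomm (e : ι → E) : σ (D e) = M (σ e) := by
    have htt : t * t⁻¹ = 1 := mul_inv_cancel₀ ht.ne'
    have htt' : t⁻¹ * t = 1 := inv_mul_cancel₀ ht.ne'
    refine Prod.ext ?_ (funext fun i => ?_)
    · rw [hMdef, LinearMap.add_apply, LinearMap.smul_apply, Prod.fst_add, Prod.smul_fst,
        cascade_fst, hM1]
      simp only [σ, hD, hLσ]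
      simp only [map_smul, map_sub, smul_add, smul_sub, smul_smul, htt, one_smul,
        ← Finset.smul_sum, Finset.sum_sub_distrib]
      abel
    · rw [hMdef, LinearMap.add_apply, LinearMap.smul_apply, Prod.snd_add, Prod.smul_snd,
        Pi.add_apply, Pi.smul_apply, cascade_snd, hM1]
      simp only [σ, hD, hLσ]
      simp only [map_smul, map_sub, smul_add, smul_sub, smul_smul, htt, htt', one_smul,
        Finset.sum_sub_distrib, LinearMap.add_apply, LinearMap.sum_apply]
      abel
  have hpow (k : ℕ) : σ ((D ^ k) e) = (M ^ k) (σ e) := by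
    induction k with
    | zero => rfl
    | succ k ih => rw [pow_succ', pow_succ', Module.End.mul_apply, Module.End.mul_apply, hcomm, ih]
  have hσ : σ e = 0 := hM.eq_zero fun k => by
    rw [← hpow, cascadeOutput_eq_zero_iff]
    obtain ⟨h1, h2⟩ := hO _ (he k)
    exact ⟨h1, fun j hj => by simp [σ, h2 j hj]⟩
  have hq0 : e q = 0 := congrArg Prod.fst hσ
  ext1 i
  have := congrFun (congrArg Prod.snd hσ) i
  simpa [σ, hq0, ht.ne'] using this

end Cascade

/-! ### Monotonicity, scaling and dimension count for Krylov subspaces -/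

section Index

variable {X U : Type*} [AddCommGroup X] [Module ℝ X] [AddCommGroup U] [Module ℝ U]

theorem controllableSubspace_mono (A : X →ₗ[ℝ] X) (B : U →ₗ[ℝ] X) {k l : ℕ} (h : k ≤ l) :
    controllableSubspace A B k ≤ controllableSubspace A B l :=
  iSup_le fun j => le_iSup (fun j : Fin l => LinearMap.range ((A ^ (j : ℕ)) ∘ₗ B)) (Fin.castLE h j)

theorem controllableSubspace_smul {s : ℝ} (hs : s ≠ 0) (A : X →ₗ[ℝ] X) (B : U →ₗ[ℝ] X) (k : ℕ) :
    controllableSubspace (s • A) B k = controllableSubspace A B k := by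
  refine iSup_congr fun j => ?_
  rw [smul_pow, LinearMap.smul_comp, LinearMap.range_smul _ _ (pow_ne_zero _ hs)]

theorem finrank_le_of_controllableSubspace_eq_top [Module.Finite ℝ U] {A : X →ₗ[ℝ] X}
    {B : U →ₗ[ℝ] X} {k : ℕ} (h : controllableSubspace A B k = ⊤) :
    Module.finrank ℝ X ≤ k * Module.finrank ℝ U := by
  rw [controllableSubspace_eq_range] at h
  have := LinearMap.finrank_range_le
    (LinearMap.lsum ℝ (fun _ : Fin k => U) ℝ fun j => (A ^ (j : ℕ)) ∘ₗ B)
  rwa [h, finrank_top, Module.finrank_pi_fintype, Finset.sum_const, Finset.card_univ,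
    Fintype.card_fin, smul_eq_mul] at this

end Index

/-! ### Choice of gains for the error system -/

section ErrorSystem

variable {n m : ℕ} {r p : Fin m → ℕ} (A : Matrix (Fin n) (Fin n) ℝ)
  (B : ∀ i, Matrix (Fin n) (Fin (r i)) ℝ) (C : ∀ i, Matrix (Fin (p i)) (Fin n) ℝ)
  (F : ∀ i, Matrix (Fin (r i)) (Fin n) ℝ) (N : Fin m → Finset (Fin m))

theorem errorDynamics_apply (K : ∀ i, Matrix (Fin n) (Fin (p i)) ℝ)
    (H : ∀ i, {j // j ∈ N i} → Matrix (Fin n) (Fin n) ℝ) (e : Fin m → Fin n → ℝ) (i : Fin m) :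
    errorDynamics A B C F N K H e i = (A + K i * C i) *ᵥ e i +
      ∑ j : {j // j ∈ N i}, H i j *ᵥ (e i - e j) + ∑ j, (B j * F j) *ᵥ (e i - e j) := rfl

theorem errorDynamics_combination (K K' : ∀ i, Matrix (Fin n) (Fin (p i)) ℝ)
    (H H' : ∀ i, {j // j ∈ N i} → Matrix (Fin n) (Fin n) ℝ) (t : ℝ) :
    errorDynamics A B C F N ((1 - t) • K + t • K') ((1 - t) • H + t • H') =
      (1 - t) • errorDynamics A B C F N K H + t • errorDynamics A B C F N K' H' := by
  refine LinearMap.ext fun e => funext fun i => ?_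
  simp only [LinearMap.add_apply, LinearMap.smul_apply, Pi.add_apply, Pi.smul_apply,
    errorDynamics_apply, Matrix.add_mul, Matrix.smul_mul, Matrix.add_mulVec, Matrix.smul_mulVec,
    Finset.sum_add_distrib, ← Finset.smul_sum]
  module

theorem lineGeneric_errorDynamics {S : ((Fin m → Fin n → ℝ) →ₗ[ℝ] (Fin m → Fin n → ℝ)) → Prop}
    (hS : LineGeneric S) :
    LineGeneric fun P : (∀ i, Matrix (Fin n) (Fin (p i)) ℝ) ×
      (∀ i, {j // j ∈ N i} → Matrix (Fin n) (Fin n) ℝ) => S (errorDynamics A B C F N P.1 P.2) := by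
  intro P P' hP
  have := hS _ (errorDynamics A B C F N P'.1 P'.2) hP
  simp only [← errorDynamics_combination] at this
  exact this

theorem errorInput_eq_single (q : Fin m) :
    errorInput n q = LinearMap.single ℝ (fun _ : Fin m => Fin n → ℝ) q := by
  refine LinearMap.ext fun u => funext fun i => ?_
  change (if i = q then u else 0) = _
  simp [Pi.single_apply]

variable {N}

theorem sum_smul_one_mulVec {h : Fin m → Fin m → ℝ} {i : Fin m} (hN : ∀ j, h i j ≠ 0 → j ∈ N i)
    (e : Fin m → Fin n → ℝ) :
    ∑ j : {j // j ∈ N i}, (h i j • (1 : Matrix (Fin n) (Fin n) ℝ)) *ᵥ (e i - e j) =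
      laplacian (Fin n → ℝ) h e i := by
  simp only [Matrix.smul_mulVec, Matrix.one_mulVec]
  rw [laplacian_apply, Finset.sum_coe_sort (N i) fun j => h i j • (e i - e j)]
  refine Finset.sum_subset (Finset.subset_univ _) fun j _ hj => ?_
  rw [not_not.1 (mt (hN j) hj), zero_smul]

/-- High gain: with `K = 0` and couplings `t⁻¹ • h`, `t` times the dynamics is the Laplacian plus
`t` times the dynamics with zero gains, and rescaling leaves Krylov subspaces unchanged. -/
theorem exists_controllable_errorDynamics (hconn : IsStronglyConnected (neighborGraph N))
    (q : Fin m) :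
    ∃ P : (∀ i, Matrix (Fin n) (Fin (p i)) ℝ) ×
        (∀ i, {j // j ∈ N i} → Matrix (Fin n) (Fin n) ℝ),
      controllableSubspace (errorDynamics A B C F N P.1 P.2) (errorInput n q) m = ⊤ := by
  obtain ⟨h, -, hs, hc⟩ := exists_controllable_laplacian q (hconn q)
  rw [Fintype.card_fin] at hc
  obtain ⟨t, ht, hct⟩ := (lineGeneric_controllableSubspace _ m).exists_ne_zero
    (controllableSubspace_laplacian_eq_top (E := Fin n → ℝ) hc) (errorDynamics A B C F N 0 0)
  refine ⟨(0, fun i j => (t⁻¹ • h) i j • 1), ?_⟩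
  rw [← hct, errorInput_eq_single, ← controllableSubspace_smul ht.ne' (errorDynamics _ _ _ _ _ _ _)]
  congr 1
  refine LinearMap.ext fun e => funext fun i => ?_
  have hN (j) (hj : (t⁻¹ • h) i j ≠ 0) : j ∈ N i :=
    (hs i j).1 fun h0 => hj (by simp [h0])
  rw [LinearMap.smul_apply, Pi.smul_apply, errorDynamics_apply, sum_smul_one_mulVec hN,
    LinearMap.add_apply, LinearMap.smul_apply, Pi.add_apply, Pi.smul_apply, errorDynamics_apply,
    laplacian_smul, LinearMap.smul_apply, Pi.smul_apply]
  simp only [Pi.zero_apply, Matrix.zero_mul, Matrix.zero_mulVec, Finset.sum_const_zero, smul_add,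
    smul_smul, mul_inv_cancel₀ ht.ne', one_smul, smul_zero]
  abel

theorem exists_observable_errorDynamics (hself : ∀ i, i ∈ N i)
    (hconn : IsStronglyConnected (neighborGraph N))
    (hobs : IsObservable (jointOutput C) A.mulVecLin) (q : Fin m) :
    ∃ P : (∀ i, Matrix (Fin n) (Fin (p i)) ℝ) ×
        (∀ i, {j // j ∈ N i} → Matrix (Fin n) (Fin n) ℝ),
      IsObservable (errorOutput C N q) (errorDynamics A B C F N P.1 P.2) := by
  obtain ⟨h, π, hs, hπ, hπh, hh⟩ := exists_observable_laplacian hconn q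
  let G : Fin m → (Fin n → ℝ) →ₗ[ℝ] (Fin n → ℝ) := fun j => (B j * F j).mulVecLin
  -- The factor `(π i)⁻¹` makes the `π`-weighted sum equal to `∑ C iᵀ C i`; pairing it with `y`
  -- gives a sum of squares, so its vanishing forces every `C i y = 0`.
  let κ : Fin m → (Fin n → ℝ) →ₗ[ℝ] (Fin n → ℝ) :=
    fun i => (π i)⁻¹ • ((C i)ᵀ * C i).mulVecLin
  have hκ (i : Fin m) (x) : κ i x = (π i)⁻¹ • ((C i)ᵀ *ᵥ (C i *ᵥ x)) := by
    rw [Matrix.mulVec_mulVec]; rfl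
  obtain ⟨t, ht, hcas⟩ := exists_isObservable_cascade (a := A.mulVecLin)
    (b := A.mulVecLin + ∑ j, G j) (κ := κ) (c := (C q).mulVecLin) (s := N q) (hself q) (hs q) hh
    hπh (fun x hx => by rw [Matrix.mulVecLin_apply] at hx; rw [hκ, hx]; simp) fun x hx => by
      refine isObservable_iff.1 hobs ?_
      ext1 j
      have h1 := (hx j j.2).2
      set y := (A.mulVecLin ^ (j : ℕ)) x with hy
      have h2 : ∑ i, (C i *ᵥ y) ⬝ᵥ (C i *ᵥ y) = 0 := by
        have := congrArg (y ⬝ᵥ ·) h1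
        simp only [hκ, smul_smul, mul_inv_cancel₀ (hπ _).ne', one_smul, dotProduct_zero,
          dotProduct_sum] at this
        rw [← this]
        refine Finset.sum_congr rfl fun i _ => ?_
        rw [Matrix.dotProduct_mulVec y, Matrix.vecMul_transpose]
      rw [map_zero]
      change (fun i => C i *ᵥ y) = 0
      ext1 i
      have h3 := (Finset.sum_eq_zero_iff_of_nonneg fun i _ => by
        exact Finset.sum_nonneg fun k _ => mul_self_nonneg _).1 h2 i (Finset.mem_univ i)
      exact dotProduct_self_eq_zero.1 h3
  obtain ⟨s, -, hD⟩ := exists_isObservable_network G hcas (errorOutput C N q) fun e he => by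
    refine ⟨congrArg Prod.fst he, fun j hj => ?_⟩
    exact sub_eq_zero.1 (congrFun (congrArg Prod.snd he) ⟨j, hj⟩)
  -- `t⁻¹` is the speed of the network and of its driving maps; `s` is the weak-feedback parameter.
  refine ⟨(fun i => (s * t⁻¹ * (π i)⁻¹) • (C i)ᵀ, fun i j => (t⁻¹ • h) i j • 1),
    hD _ fun e i => ?_⟩
  have hN (j) (hj : (t⁻¹ • h) i j ≠ 0) : j ∈ N i :=
    hs i j fun h0 => hj (by simp [h0])
  rw [errorDynamics_apply, sum_smul_one_mulVec hN, Pi.smul_apply, LinearMap.smul_apply, hκ]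
  simp only [G, Matrix.mulVecLin_apply, Matrix.add_mulVec, Matrix.smul_mul, Matrix.smul_mulVec,
    Matrix.mulVec_mulVec, smul_smul, mul_assoc]

end ErrorSystem

end MultiChannel

theorem proposition1 (n m : ℕ) (hn : 0 < n) (hm : 0 < m) (r p : Fin m → ℕ)
    (A : Matrix (Fin n) (Fin n) ℝ)
    (B : ∀ i, Matrix (Fin n) (Fin (r i)) ℝ)
    (C : ∀ i, Matrix (Fin (p i)) (Fin n) ℝ)
    (hctrl : MultiChannel.IsControllable A.mulVecLin (MultiChannel.jointInput B))
    (hobs : MultiChannel.IsObservable (MultiChannel.jointOutput C) A.mulVecLin)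
    (N : Fin m → Finset (Fin m)) (hself : ∀ i, i ∈ N i)
    (hconn : MultiChannel.IsStronglyConnected (MultiChannel.neighborGraph N))
    (F : ∀ i, Matrix (Fin (r i)) (Fin n) ℝ) :
    ∃ (K : ∀ i, Matrix (Fin n) (Fin (p i)) ℝ)
      (H : ∀ i, {j // j ∈ N i} → Matrix (Fin n) (Fin n) ℝ),
      ∀ q : Fin m,
        MultiChannel.IsObservable (MultiChannel.errorOutput C N q)
            (MultiChannel.errorDynamics A B C F N K H) ∧
        MultiChannel.IsControllable (MultiChannel.errorDynamics A B C F N K H)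
            (MultiChannel.errorInput n q) ∧
        MultiChannel.HasControllabilityIndex (MultiChannel.errorDynamics A B C F N K H)
            (MultiChannel.errorInput n q) m := by
  open MultiChannel in
  have hgo (q : Fin m) := lineGeneric_errorDynamics A B C F N
    (lineGeneric_isObservable (errorOutput C N q))
  have hgc (q : Fin m) := lineGeneric_errorDynamics A B C F N
    (lineGeneric_controllableSubspace (errorInput n q) m)
  -- Full rank is imposed already at `m` steps, which gives both controllability and the upper bound
  -- on the index.
  obtain ⟨⟨K, H⟩, hKH⟩ := LineGeneric.exists_forall (fun q => (hgo q).and (hgc q)) fun q =>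
    (hgo q).exists_and (hgc q) (exists_observable_errorDynamics A B C F hself hconn hobs q)
      (exists_controllable_errorDynamics A B C F hconn q)
  have hrank : Module.finrank ℝ (Fin m → Fin n → ℝ) = m * n := by
    simp [Module.finrank_pi_fintype]
  refine ⟨K, H, fun q => ⟨(hKH q).1, ?_, (hKH q).2, fun l hl => ?_⟩⟩
  · rw [IsControllable, hrank, eq_top_iff, ← (hKH q).2]
    exact controllableSubspace_mono _ _ (Nat.le_mul_of_pos_right m hn)
  -- Spanning `m * n` dimensions with `l` blocks of width `n` forces `m ≤ l`.
  · have := finrank_le_of_controllableSubspace_eq_top hl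
    rw [hrank, Module.finrank_fin_fun] at this
    exact Nat.le_of_mul_le_mul_right this hn
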